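/- **Theorem (Independent joint limit processes: $\mu_{A_l}$ versus $\mu$).** Let $(X,\mathcal A,\mu)$ be a probability space, $T:X\to X$ an ergodic $\mu$-preserving map, and $(A_l)_{l\ge1}$ a sequence in $\mathcal A$ with $0<\mu(A_l)\to0$. For $A\in\mathcal A$ with $\mu(A)>0$ let $\mu_A(B):=\mu(A\cap B)/\mu(A)$, let $\varphi_A(x):=\inf\{n\ge1:T^nx\in A\}\in\{1,2,\dots,\infty\}$ be the first hitting time, let $T_Ax:=T^{\varphi_A(x)}x$ (defined for $\mu$-a.e. $x$), and let $\Phi_A:=(\varphi_A,\varphi_A\circ T_A,\varphi_A\circ T_A^2,\dots)$. Let $\mathfrak F$ be a compact metric space with its Borel $\sigma$-algebra. For every $l$ let $\psi_{A_l}:A_l\to\mathfrak F$ be measurable, and put $$\Psi_{A_l}:=(\psi_{A_l}\circ T_{A_l},\psi_{A_l}\circ T_{A_l}^2,\dots)\ \text{ a.e. on }X,\qquad \widetilde\Psi_{A_l}:=(\psi_{A_l},\psi_{A_l}\circ T_{A_l},\psi_{A_l}\circ T_{A_l}^2,\dots)\ \text{ a.e. on }A_l.$$ Let $\mathfrak P$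 be the set of probability measures $\nu\ll\mu$ on $(X,\mathcal A)$, with the total variation distance $d_{\mathfrak P}(\nu,\nu'):=2\sup_{B\in\mathcal A}|\nu(B)-\nu'(B)|$. Assume that there are measurable functions $\tau_l:X\to\{0,1,2,\dots\}$ with $$\mu_{A_l}(\tau_l<\varphi_{A_l})\longrightarrow1\quad\text{as }l\to\infty,$$ and a compact subset $\mathfrak K$ of $(\mathfrak P,d_{\mathfrak P})$ such that $T^{\tau_l}_*\mu_{A_l}\in\mathfrak K$ for all $l\ge1$, where $T^{\tau_l}x:=T^{\tau_l(x)}x$ and $T^{\tau_l}_*\mu_{A_l}$ is the image measure. Let $\Phi_{\mathrm{Exp}}$ be an iid sequence of exponentially distributed random variables with mean $1$, and let $\Psi^*$ be an iid sequence in $\mathfrak F$ (with an arbitrary common law) that is independent of $\Phi_{\mathrm{Exp}}$. Then $$(\mu(A_l)\Phi_{A_l},\Psi_{A_l})\ \text{ under }\mu\ \text{ converges in distribution to }(\Phi_{\mathrm{Exp}},\Psi^*)\quad\text{as }l\to\infty$$ if and only if $$(\mu(A_l)\Phi_{A_l},\widetilde\Psi_{A_l})\ \text{ under }\mu_{A_l}\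 \text{ converges in distribution to }(\Phi_{\mathrm{Exp}},\Psi^*)\quad\text{as }l\to\infty.$$ Here convergence in distribution means weak convergence of the laws on the compact space $[0,\infty]^{\{0,1,2,\dots\}}\times\mathfrak F^{\{0,1,2,\dots\}}$ with the product topology (the sequence $\Psi_{A_l}$ being re-indexed to start at $0$). -/

import Mathlib

open MeasureTheory ProbabilityTheory Filter Topology
open scoped ENNReal

namespace RareEvents

/-- The set `𝔓` of probability measures on `X` that are absolutely continuous with respect to `μ`,
equipped below with the total variation distance. -/
structure AbsContProb {X : Type*} [MeasurableSpace X] (μ : Measure X) where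
  toMeasure : Measure X
  isProb : IsProbabilityMeasure toMeasure
  absCont : toMeasure ≪ μ

namespace AbsContProb

variable {X : Type*} [MeasurableSpace X] {μ : Measure X}

theorem toMeasure_injective :
    Function.Injective (toMeasure : AbsContProb μ → Measure X) := by
  rintro ⟨a, _, _⟩ ⟨b, _, _⟩ h
  cases h
  rfl

/-- `d(ν, ν') = 2 sup_A |ν(A) - ν'(A)|`, the supremum over all measurable sets `A`. -/
noncomputable def tvDist (ν ν' : AbsContProb μ) : ℝ :=
  2 * ⨆ A : {A : Set X // MeasurableSet A}, |ν.toMeasure.real A - ν'.toMeasure.real A|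

theorem real_le_one (ν : AbsContProb μ) (A : Set X) : ν.toMeasure.real A ≤ 1 :=
  haveI := ν.isProb
  measureReal_le_one

theorem abs_sub_le_one (ν ν' : AbsContProb μ) (A : Set X) :
    |ν.toMeasure.real A - ν'.toMeasure.real A| ≤ 1 := by
  have h1 := ν.real_le_one A
  have h2 := ν'.real_le_one A
  have h3 : 0 ≤ ν.toMeasure.real A := measureReal_nonneg
  have h4 : 0 ≤ ν'.toMeasure.real A := measureReal_nonneg
  rw [abs_le]
  constructor <;> linarith

theorem bddAbove_range (ν ν' : AbsContProb μ) :
    BddAbove (Set.range fun A : {A : Set X // MeasurableSet A} =>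
      |ν.toMeasure.real A - ν'.toMeasure.real A|) :=
  ⟨1, by rintro _ ⟨A, rfl⟩; exact abs_sub_le_one ν ν' A⟩

theorem abs_sub_le_tvDist (ν ν' : AbsContProb μ) {A : Set X} (hA : MeasurableSet A) :
    2 * |ν.toMeasure.real A - ν'.toMeasure.real A| ≤ tvDist ν ν' :=
  mul_le_mul_of_nonneg_left (le_ciSup (bddAbove_range ν ν') ⟨A, hA⟩) zero_le_two

noncomputable instance : MetricSpace (AbsContProb μ) where
  dist := tvDist
  dist_self ν := by simp [tvDist]
  dist_comm ν ν' := by simp only [tvDist, abs_sub_comm]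
  dist_triangle ν₁ ν₂ ν₃ := by
    haveI : Nonempty {A : Set X // MeasurableSet A} := ⟨⟨∅, MeasurableSet.empty⟩⟩
    have key : (⨆ A : {A : Set X // MeasurableSet A},
        |ν₁.toMeasure.real A - ν₃.toMeasure.real A|) ≤
        (⨆ A : {A : Set X // MeasurableSet A}, |ν₁.toMeasure.real A - ν₂.toMeasure.real A|) +
        ⨆ A : {A : Set X // MeasurableSet A}, |ν₂.toMeasure.real A - ν₃.toMeasure.real A| :=
      ciSup_le fun A => (abs_sub_le _ (ν₂.toMeasure.real A) _).trans
        (add_le_add (le_ciSup (bddAbove_range ν₁ ν₂) A) (le_ciSup (bddAbove_range ν₂ ν₃) A))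
    simp only [tvDist]
    linarith
  eq_of_dist_eq_zero := by
    intro ν ν' h
    apply toMeasure_injective
    haveI := ν.isProb
    haveI := ν'.isProb
    refine Measure.ext fun A hA => ?_
    have h1 := abs_sub_le_tvDist ν ν' hA
    change tvDist ν ν' = 0 at h
    have h2 : |ν.toMeasure.real A - ν'.toMeasure.real A| = 0 :=
      le_antisymm (by linarith) (abs_nonneg _)
    have h3 : ν.toMeasure.real A = ν'.toMeasure.real A := sub_eq_zero.mp (abs_eq_zero.mp h2)
    exact (measureReal_eq_measureReal_iff).mp h3

end AbsContProb

section Dynamics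

variable {X : Type*}

/-- The first hitting time `φ_A(x) = inf {n ≥ 1 : T^n x ∈ A} ∈ {1, 2, …, ∞}`. -/
noncomputable def hitTime (T : X → X) (A : Set X) (x : X) : ℕ∞ :=
  ⨅ (n : ℕ) (_ : 1 ≤ n ∧ T^[n] x ∈ A), (n : ℕ∞)

/-- The induced map `T^τ x = T^{τ(x)} x` of a random time `τ`. -/
def timeMap (T : X → X) (τ : X → ℕ) (x : X) : X :=
  T^[τ x] x

/-- The first entrance map `T_A x = T^{φ_A(x)} x`. On the null set where `φ_A = ∞` it is given the
conventional value `x`. -/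
noncomputable def entranceMap (T : X → X) (A : Set X) : X → X :=
  timeMap T fun x => (hitTime T A x).toNat

/-- The normalized hitting-time process `μ(A) Φ_A = μ(A) (φ_A, φ_A ∘ T_A, φ_A ∘ T_A², …)`. -/
noncomputable def hitProcess [MeasurableSpace X] (μ : Measure X) (T : X → X) (A : Set X) (x : X) :
    ℕ → ℝ≥0∞ :=
  fun j => μ A * (hitTime T A ((entranceMap T A)^[j] x) : ℝ≥0∞)

variable {F : Type*} [Nonempty F]

open scoped Classical in
/-- A local observable `ψ_A : A → F` as a function on `X`, with an arbitrary constant value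
off `A`. This value only enters the processes below on null sets. -/
noncomputable def extendObs {A : Set X} (ψ : A → F) (x : X) : F :=
  if h : x ∈ A then ψ ⟨x, h⟩ else Classical.arbitrary F

/-- The local process `Ψ̃_A = (ψ_A, ψ_A ∘ T_A, ψ_A ∘ T_A², …)`. -/
noncomputable def localProcessFromZero (T : X → X) {A : Set X} (ψ : A → F) (x : X) : ℕ → F :=
  fun j => extendObs ψ ((entranceMap T A)^[j] x)

/-- The local process `Ψ_A = (ψ_A ∘ T_A, ψ_A ∘ T_A², …)`. -/
noncomputable def localProcess (T : X → X) {A : Set X} (ψ : A → F) (x : X) : ℕ → F :=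
  fun j => extendObs ψ ((entranceMap T A)^[j + 1] x)

end Dynamics

/-- An iid sequence of random elements of `E` on the probability space `(Ω, P)`. -/
structure IsIID {Ω E : Type*} [MeasurableSpace Ω] [MeasurableSpace E] (Z : ℕ → Ω → E)
    (P : Measure Ω) : Prop where
  measurable : ∀ j, Measurable (Z j)
  indep : iIndepFun Z P
  identDistrib : ∀ j, IdentDistrib (Z j) (Z 0) P P

end RareEvents

/-! Write `R` for the joint process `(μ(A) Φ_A, Ψ_A)`. Moving a point from `x` to `T x` changes only
the first waiting time of `R`, by `μ(A)`, unless `T x ∈ A`; hence `R` is asymptotically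
`T`-invariant. By ergodicity, its asymptotic law is then the same under every `ν ≪ μ`, uniformly
over compact sets of such `ν` (`tendsto_integral_sub_integral_of_isCompact`). Applied to the images
of `μ_A` under `T^τ`, this compares `R ∘ T^τ` under `μ_A` with `R` under `μ`.

Where `τ < φ_A`, the processes `R ∘ T^τ` and `R` differ only in the first waiting time, which the
delay shortens by `μ(A) τ`. Nothing bounds this quantity directly. But the sign is known, so the
change is small in mean as soon as the Laplace transforms at `1` of `μ(A) φ_A` under `μ` and under
`μ_A` agree asymptotically. A Kac-type identity (`integral_expNeg_mul_hitTime`) says that in the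
limit these two values sum to `1`. The exponential value `1/2` is the fixed point of `s ↦ 1 - s`, so
either side of the equivalence supplies the agreement, and then `R` has the same asymptotic law
under `μ_A` as under `μ` (`tendsto_integral_cond_sub_integral`).

It remains to relate `Ψ_A` to `Ψ̃_A`: they differ by a shift of one component. The law `μ_A` is
invariant under `T_A`, and the limit law is invariant under shifting either component alone. -/

namespace RareEvents

/-! ### Hitting times, entrance maps and measurability -/

section HittingTimes

variable {X : Type*} {T : X → X} {A : Set X} {x : X}

theorem hitTime_of_mem (h : T x ∈ A) : hitTime T A x = 1 :=
  le_antisymm (iInf₂_le 1 ⟨le_rfl, h⟩) (le_iInf₂ fun _ hm => by exact_mod_cast hm.1)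

theorem hitTime_of_notMem (h : T x ∉ A) : hitTime T A x = hitTime T A (T x) + 1 := by
  apply le_antisymm
  · rw [← tsub_le_iff_right]
    refine le_iInf₂ fun m hm => ?_
    rw [tsub_le_iff_right]
    exact iInf₂_le (m + 1) ⟨by omega, hm.2⟩
  · refine le_iInf₂ fun m hm => ?_
    obtain ⟨k, rfl⟩ : ∃ k, m = k + 1 := ⟨m - 1, by omega⟩
    have hk : 1 ≤ k := by
      by_contra hk
      obtain rfl : k = 0 := by omega
      exact h (by simpa using hm.2)
    have : hitTime T A (T x) ≤ k := iInf₂_le k ⟨hk, by simpa using hm.2⟩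
    push_cast
    gcongr

theorem one_le_hitTime : 1 ≤ hitTime T A x :=
  le_iInf₂ fun _ hm => by exact_mod_cast hm.1

theorem entranceMap_of_mem (h : T x ∈ A) : entranceMap T A x = T x := by
  simp [entranceMap, timeMap, hitTime_of_mem h]

/-- Finiteness matters: at an infinite hitting time the conventional value is the point itself,
which varies along the orbit. -/
theorem entranceMap_of_notMem (h : T x ∉ A) (hx : hitTime T A (T x) ≠ ⊤) :
    entranceMap T A x = entranceMap T A (T x) := by
  simp only [entranceMap, timeMap, hitTime_of_notMem h]
  rw [ENat.toNat_add hx ENat.one_ne_top]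
  simp

/-- Before the first hitting time, moving along the orbit only decreases the hitting time. -/
theorem hitTime_iterate_add {n : ℕ} (hn : (n : ℕ∞) < hitTime T A x) (hx : hitTime T A x ≠ ⊤) :
    hitTime T A (T^[n] x) + n = hitTime T A x ∧
      entranceMap T A (T^[n] x) = entranceMap T A x := by
  induction n generalizing x with
  | zero => simp
  | succ n ih =>
    have h : T x ∉ A := fun h => by
      rw [hitTime_of_mem h] at hn
      norm_cast at hn
    have h1 := hitTime_of_notMem h
    have h2 : hitTime T A (T x) ≠ ⊤ := fun h2 => hx (by rw [h1, h2]; simp)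
    have h3 : (n : ℕ∞) < hitTime T A (T x) := by
      rw [h1] at hn
      push_cast at hn
      exact lt_of_add_lt_add_right hn
    obtain ⟨h4, h5⟩ := ih h3 h2
    rw [Function.iterate_succ_apply, h5, entranceMap_of_notMem h h2, h1, ← h4]
    exact ⟨by push_cast; ring, rfl⟩

variable [MeasurableSpace X]

theorem measurable_hitTime (hT : Measurable T) (hA : MeasurableSet A) :
    Measurable (hitTime T A) := by
  have key : ∀ n : ℕ, MeasurableSet (hitTime T A ⁻¹' {(n : ℕ∞)}) := by
    intro n
    induction n with
    | zero =>
      convert MeasurableSet.empty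
      ext x
      simpa using (zero_lt_one.trans_le (one_le_hitTime (T := T) (A := A) (x := x))).ne'
    | succ n ih =>
      -- Entering `A` in one step gives the value `1`, so the first piece contributes only for `n =
      -- 0`.
      have : hitTime T A ⁻¹' {((n + 1 : ℕ) : ℕ∞)} =
          (T ⁻¹' A ∩ {_x | n = 0}) ∪ (T ⁻¹' Aᶜ ∩ T ⁻¹' (hitTime T A ⁻¹' {(n : ℕ∞)})) := by
        ext x
        by_cases h : T x ∈ A
        · simp only [Set.mem_preimage, hitTime_of_mem h, Set.mem_singleton_iff, Set.mem_union,
            Set.mem_inter_iff, h, Set.mem_ofPred_eq, true_and, Set.mem_compl_iff, not_true_eq_false,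
            false_and, or_false]
          norm_cast
          omega
        · simp [hitTime_of_notMem h, h]
      rw [this]
      exact ((hT hA).inter (MeasurableSet.const _)).union ((hT hA.compl).inter (hT ih))
  refine measurable_to_countable' fun y => ?_
  induction y using ENat.recTopCoe with
  | coe n => exact key n
  | top =>
    have : hitTime T A ⁻¹' {⊤} = (⋃ n : ℕ, hitTime T A ⁻¹' {(n : ℕ∞)})ᶜ := by
      ext x
      simp only [Set.mem_preimage, Set.mem_singleton_iff, Set.mem_compl_iff, Set.mem_iUnion]
      rw [← not_iff_not, not_not, ← Ne, ENat.ne_top_iff_exists]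
      simp [eq_comm]
    rw [this]
    exact (MeasurableSet.iUnion key).compl

theorem measurable_timeMap (hT : Measurable T) {τ : X → ℕ} (hτ : Measurable τ) :
    Measurable (timeMap T τ) :=
  (measurable_from_prod_countable_right (f := fun p : ℕ × X => T^[p.1] p.2)
    fun n => hT.iterate n).comp (hτ.prodMk measurable_id)

theorem measurable_entranceMap (hT : Measurable T) (hA : MeasurableSet A) :
    Measurable (entranceMap T A) :=
  measurable_timeMap hT ((Measurable.of_discrete (f := ENat.toNat)).comp (measurable_hitTime hT hA))

/-- The set `{φ_A = ∞}` is contained in its own preimage, hence null or conull; if conull, `T⁻¹ A`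
would be null, against invariance of `μ`. -/
theorem ae_hitTime_ne_top {μ : Measure X} [IsFiniteMeasure μ] (hT : Ergodic T μ)
    (hA : MeasurableSet A) (hpos : 0 < μ A) : ∀ᵐ x ∂μ, hitTime T A x ≠ ⊤ := by
  have hm : MeasurableSet {x | hitTime T A x = ⊤} :=
    measurable_hitTime hT.measurable hA (measurableSet_singleton ⊤)
  have hsub : {x | hitTime T A x = ⊤} ⊆ T ⁻¹' {x | hitTime T A x = ⊤} := by
    intro x (hx : hitTime T A x = ⊤)
    have h : T x ∉ A := fun h => by simp [hitTime_of_mem h] at hx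
    rw [hitTime_of_notMem h] at hx
    simpa using hx
  rcases hT.ae_empty_or_univ_of_ae_le_preimage hm.nullMeasurableSet hsub.eventuallyLE with h | h
  · exact measure_eq_zero_iff_ae_notMem.mp (ae_eq_empty.mp h)
  · exfalso
    rw [eventuallyEq_univ] at h
    have h0 : μ (T ⁻¹' A) = 0 := by
      refine measure_mono_null ?_ h
      intro x hx
      simp [hitTime_of_mem (show T x ∈ A from hx)]
    rw [hT.measure_preimage hA.nullMeasurableSet] at h0
    exact hpos.ne' h0

theorem measurable_hitProcess {μ : Measure X} (hT : Measurable T) (hA : MeasurableSet A) :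
    Measurable (hitProcess μ T A) := by
  refine measurable_pi_lambda _ fun j => ?_
  exact ((Measurable.of_discrete (f := ENat.toENNReal)).comp ((measurable_hitTime hT hA).comp
    ((measurable_entranceMap hT hA).iterate j))).const_mul _

variable {F : Type*} [Nonempty F] [MeasurableSpace F] {ψ : A → F}

theorem measurable_extendObs (hA : MeasurableSet A) (hψ : Measurable ψ) :
    Measurable (extendObs ψ) := by
  classical
  exact Measurable.dite hψ measurable_const hA

theorem measurable_localProcessFromZero (hT : Measurable T) (hA : MeasurableSet A)
    (hψ : Measurable ψ) : Measurable (localProcessFromZero T ψ) :=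
  measurable_pi_lambda _ fun j => (measurable_extendObs hA hψ).comp
    ((measurable_entranceMap hT hA).iterate j)

theorem measurable_localProcess (hT : Measurable T) (hA : MeasurableSet A)
    (hψ : Measurable ψ) : Measurable (localProcess T ψ) :=
  measurable_pi_lambda _ fun j => (measurable_extendObs hA hψ).comp
    ((measurable_entranceMap hT hA).iterate (j + 1))

end HittingTimes

/-! ### The function `e^{-x}` as a coordinate on `[0, ∞]` -/

/-- The function `x ↦ e^{-x}` on `[0, ∞]`. -/
noncomputable def expNeg (x : ℝ≥0∞) : ℝ := (EReal.exp (-(x : EReal))).toReal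

theorem exp_neg_coe_ne_top (x : ℝ≥0∞) : EReal.exp (-(x : EReal)) ≠ ⊤ := by
  simp [EReal.neg_eq_top_iff]

theorem continuous_expNeg : Continuous expNeg :=
  ENNReal.continuousOn_toReal.comp_continuous
    (ENNReal.continuous_exp.comp (continuous_neg.comp continuous_coe_ennreal_ereal))
    exp_neg_coe_ne_top

theorem expNeg_injective : Function.Injective expNeg := fun x y h => by
  have := (ENNReal.toReal_eq_toReal_iff' (exp_neg_coe_ne_top x) (exp_neg_coe_ne_top y)).mp h
  simpa using EReal.exp_strictMono.injective this

@[simp] theorem expNeg_top : expNeg ⊤ = 0 := by simp [expNeg]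

@[simp] theorem expNeg_zero : expNeg 0 = 1 := by simp [expNeg]

theorem expNeg_ofReal {x : ℝ} (hx : 0 ≤ x) : expNeg (ENNReal.ofReal x) = Real.exp (-x) := by
  rw [expNeg, EReal.coe_ennreal_ofReal, max_eq_left hx, ← EReal.coe_neg, EReal.exp_coe,
    ENNReal.toReal_ofReal (Real.exp_pos _).le]

theorem expNeg_eq_exp {x : ℝ≥0∞} (hx : x ≠ ⊤) : expNeg x = Real.exp (-x.toReal) := by
  conv_lhs => rw [← ENNReal.ofReal_toReal hx]
  exact expNeg_ofReal ENNReal.toReal_nonneg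

theorem expNeg_add (x y : ℝ≥0∞) : expNeg (x + y) = expNeg x * expNeg y := by
  by_cases hx : x = ⊤
  · simp [hx]
  by_cases hy : y = ⊤
  · simp [hy]
  rw [expNeg_eq_exp hx, expNeg_eq_exp hy, expNeg_eq_exp (by finiteness),
    ENNReal.toReal_add hx hy, ← Real.exp_add]
  ring_nf

theorem expNeg_nonneg (x : ℝ≥0∞) : 0 ≤ expNeg x := ENNReal.toReal_nonneg

theorem expNeg_le_one (x : ℝ≥0∞) : expNeg x ≤ 1 := by
  by_cases hx : x = ⊤
  · simp [hx]
  · simp [expNeg_eq_exp hx]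

theorem abs_expNeg_le_one (x : ℝ≥0∞) : |expNeg x| ≤ 1 := by
  rw [abs_of_nonneg (expNeg_nonneg x)]
  exact expNeg_le_one x

theorem antitone_expNeg : Antitone expNeg := fun x y h => by
  obtain ⟨z, rfl⟩ := exists_add_of_le h
  rw [expNeg_add]
  exact mul_le_of_le_one_right (expNeg_nonneg x) (expNeg_le_one z)

/-- A continuous function on a product is controlled, in its first variable, by the distance
`|e^{-x} - e^{-y}|` on `[0, ∞]`. -/
theorem exists_abs_sub_le_add_mul_expNeg {E : Type*} [TopologicalSpace E] [CompactSpace E]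
    (f : C(ℝ≥0∞ × E, ℝ)) {δ : ℝ} (hδ : 0 < δ) :
    ∃ C : ℝ, 0 ≤ C ∧ ∀ x y z, |f (x, z) - f (y, z)| ≤ δ + C * |expNeg x - expNeg y| := by
  have hG : Continuous f.curry := f.curry.continuous
  -- Currying makes the distance uniform in `z`. On the compact set `S` the quantity `|e^{-x} -
  -- e^{-y}|` has a positive minimum `η` by injectivity, so `2‖f‖/η` serves as `C`.
  let S : Set (ℝ≥0∞ × ℝ≥0∞) := {p | δ ≤ dist (f.curry p.1) (f.curry p.2)}
  have hS : IsCompact S :=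
    (isClosed_le continuous_const ((hG.comp continuous_fst).dist (hG.comp continuous_snd))).isCompact
  have hd : Continuous fun p : ℝ≥0∞ × ℝ≥0∞ => |expNeg p.1 - expNeg p.2| :=
    ((continuous_expNeg.comp continuous_fst).sub (continuous_expNeg.comp continuous_snd)).abs
  have hη : ∃ η > 0, ∀ p ∈ S, η ≤ |expNeg p.1 - expNeg p.2| := by
    rcases S.eq_empty_or_nonempty with h | h
    · exact ⟨1, one_pos, by simp [h]⟩
    · obtain ⟨p, hp, hmin⟩ := hS.exists_isMinOn h hd.continuousOn
      refine ⟨|expNeg p.1 - expNeg p.2|, ?_, fun q hq => hmin hq⟩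
      rw [gt_iff_lt, abs_pos, sub_ne_zero]
      intro h
      have hp' : δ ≤ dist (f.curry p.1) (f.curry p.2) := hp
      rw [expNeg_injective h, dist_self] at hp'
      exact absurd hp' (not_le.mpr hδ)
  obtain ⟨η, hη, hS'⟩ := hη
  refine ⟨2 * ‖f‖ / η, by positivity, fun x y z => ?_⟩
  by_cases h : (x, y) ∈ S
  · have h1 : |f (x, z) - f (y, z)| ≤ 2 * ‖f‖ := by
      refine (abs_sub _ _).trans ?_
      linarith [f.norm_coe_le_norm (x, z), f.norm_coe_le_norm (y, z),
        Real.norm_eq_abs (f (x, z)), Real.norm_eq_abs (f (y, z))]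
    have h2 : 2 * ‖f‖ ≤ 2 * ‖f‖ / η * |expNeg x - expNeg y| := by
      calc 2 * ‖f‖ = 2 * ‖f‖ / η * η := by field_simp
        _ ≤ _ := by gcongr; exact hS' _ h
    linarith
  · have h1 : dist (f.curry x) (f.curry y) < δ := not_le.mp h
    have h2 : |f (x, z) - f (y, z)| ≤ dist (f.curry x) (f.curry y) := by
      have := ContinuousMap.dist_apply_le_dist (f := f.curry x) (g := f.curry y) z
      simpa [Real.dist_eq] using this
    have : 0 ≤ 2 * ‖f‖ / η * |expNeg x - expNeg y| := by positivity
    linarith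

/-! ### Asymptotic invariance and change of measure -/

section StrongConvergence

variable {X : Type*} [MeasurableSpace X] {μ : Measure X} {T : X → X}

/-- For an ergodic map, square integrable functions of mean zero are approximated by coboundaries
of the adjoint of the Koopman operator. -/
theorem exists_adjoint_coboundary_norm_sub_lt (hT : Ergodic T μ) (v : Lp ℝ 2 μ)
    (hv : ∫ x, v x ∂μ = 0) {ε : ℝ} (hε : 0 < ε) :
    ∃ w : Lp ℝ 2 μ, ‖v - (ContinuousLinearMap.adjoint
      ((Lp.compMeasurePreservingₗᵢ ℝ T hT.toMeasurePreserving).toContinuousLinearMap -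
        ContinuousLinearMap.id ℝ (Lp ℝ 2 μ))) w‖ < ε := by
  set V : Lp ℝ 2 μ →L[ℝ] Lp ℝ 2 μ :=
    (Lp.compMeasurePreservingₗᵢ ℝ T hT.toMeasurePreserving).toContinuousLinearMap -
      ContinuousLinearMap.id ℝ (Lp ℝ 2 μ) with hV
  -- The kernel of `V` consists of invariant functions, which ergodicity makes constant; its
  -- orthogonal complement is the closure of the range of the adjoint.
  have hmem : v ∈ V.kerᗮ := by
    rw [Submodule.mem_orthogonal]
    intro w hw
    have hw' : Lp.compMeasurePreserving T hT.toMeasurePreserving w = w :=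
      sub_eq_zero.mp (show V w = 0 from hw)
    have h1 : (w : X → ℝ) ∘ T =ᵐ[μ] w := by
      have := Lp.coeFn_compMeasurePreserving w hT.toMeasurePreserving
      rw [hw'] at this
      exact this.symm
    obtain ⟨c, hc⟩ := hT.ae_eq_const_of_ae_eq_comp_ae (Lp.aestronglyMeasurable w) h1
    rw [L2.inner_def]
    calc ∫ x, inner ℝ (w x) (v x) ∂μ = ∫ x, c * v x ∂μ := by
          refine integral_congr_ae ?_
          filter_upwards [hc] with x hx
          simp [hx, mul_comm]
      _ = 0 := by rw [integral_const_mul, hv, mul_zero]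
  rw [V.orthogonal_ker] at hmem
  obtain ⟨y, hy, hd⟩ := Metric.mem_closure_iff.mp hmem ε hε
  obtain ⟨w, rfl⟩ := hy
  exact ⟨w, by rw [← dist_eq_norm]; exact hd⟩

variable [IsProbabilityMeasure μ]

/-- If `v = V* w` with `V g = g ∘ T - g`, then `⟨g, v⟩ = ⟨V g, w⟩`, which is small by asymptotic
invariance. Such `v` are dense among mean-zero functions, and the `g l` are bounded in `L²`. -/
theorem tendsto_integral_mul_of_asymptotically_invariant (hT : Ergodic T μ) {g : ℕ → X → ℝ}
    (hg : ∀ l, Measurable (g l)) {M : ℝ} (hM : ∀ l x, |g l x| ≤ M)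
    (hinv : Tendsto (fun l => ∫ x, |g l (T x) - g l x| ∂μ) atTop (𝓝 0))
    {v : X → ℝ} (hv : MemLp v 2 μ) (hv0 : ∫ x, v x ∂μ = 0) :
    Tendsto (fun l => ∫ x, g l x * v x ∂μ) atTop (𝓝 0) := by
  have hM0 : 0 ≤ M := by
    have : Nonempty X := Measure.nonempty_of_neZero μ
    exact (abs_nonneg _).trans (hM 0 (Classical.arbitrary X))
  have hgL : ∀ l, MemLp (g l) 2 μ := fun l =>
    MemLp.of_bound (hg l).aestronglyMeasurable M (Eventually.of_forall fun x => hM l x)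
  set V : Lp ℝ 2 μ →L[ℝ] Lp ℝ 2 μ :=
    (Lp.compMeasurePreservingₗᵢ ℝ T hT.toMeasurePreserving).toContinuousLinearMap -
      ContinuousLinearMap.id ℝ (Lp ℝ 2 μ) with hV
  let G : ℕ → Lp ℝ 2 μ := fun l => (hgL l).toLp
  have hG : ∀ l, ‖G l‖ ≤ M := fun l => by
    have := Lp.norm_le_of_ae_bound (f := G l) hM0 (by
      filter_upwards [(hgL l).coeFn_toLp] with x hx
      rw [show G l x = g l x from hx]
      exact hM l x)
    simpa [measureUnivNNReal] using this
  -- Boundedness upgrades `L¹` invariance to `L²`.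
  have hVG : ∀ l, ‖V (G l)‖ ^ 2 ≤ 2 * M * ∫ x, |g l (T x) - g l x| ∂μ := by
    intro l
    have hae : V (G l) =ᵐ[μ] fun x => g l (T x) - g l x := by
      have h1 := Lp.coeFn_sub (Lp.compMeasurePreserving T hT.toMeasurePreserving (G l)) (G l)
      have h2 := Lp.coeFn_compMeasurePreserving (G l) hT.toMeasurePreserving
      have h3 := (hgL l).coeFn_toLp
      have h4 := hT.quasiMeasurePreserving.ae_eq_comp h3
      filter_upwards [h1, h2, h3, h4] with x h1 h2 h3 h4
      change (Lp.compMeasurePreserving T hT.toMeasurePreserving (G l) - G l : Lp ℝ 2 μ) x = _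
      rw [h1, Pi.sub_apply, h2, h3]
      simpa using h4
    rw [← real_inner_self_eq_norm_sq, L2.inner_def, ← integral_const_mul]
    have hmeas : Measurable fun x => g l (T x) - g l x :=
      ((hg l).comp hT.measurable).sub (hg l)
    have hb : ∀ x, |g l (T x) - g l x| ≤ 2 * M := fun x =>
      (abs_sub _ _).trans (by linarith [hM l x, hM l (T x)])
    refine integral_mono_ae (L2.integrable_inner _ _) ?_ ?_
    · exact (Integrable.of_bound hmeas.abs.aestronglyMeasurable (2 * M)
        (Eventually.of_forall fun x => by simpa using hb x)).const_mul _
    · filter_upwards [hae] with x hx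
      rw [hx]
      simp only [RCLike.inner_apply, conj_trivial]
      rw [← abs_mul_abs_self]
      exact mul_le_mul_of_nonneg_right (hb x) (abs_nonneg _)
  have hVG0 : Tendsto (fun l => ‖V (G l)‖) atTop (𝓝 0) := by
    have h1 : Tendsto (fun l => ‖V (G l)‖ ^ 2) atTop (𝓝 0) :=
      squeeze_zero (fun l => sq_nonneg _) hVG (by simpa using hinv.const_mul (2 * M))
    have h2 := h1.sqrt
    simpa [Real.sqrt_sq] using h2
  have hvL : ∫ x, hv.toLp v x ∂μ = 0 := by rw [integral_congr_ae hv.coeFn_toLp, hv0]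
  have hint : ∀ l, ∫ x, g l x * v x ∂μ = inner ℝ (G l) (hv.toLp v) := fun l => by
    rw [L2.inner_def]
    refine integral_congr_ae ?_
    filter_upwards [(hgL l).coeFn_toLp, hv.coeFn_toLp] with x h1 h2
    simp [G, h1, h2, mul_comm]
  rw [Metric.tendsto_atTop']
  intro ε hε
  obtain ⟨w, hw⟩ := exists_adjoint_coboundary_norm_sub_lt hT (hv.toLp v) hvL
    (ε := ε / (2 * (M + 1))) (by positivity)
  rw [← hV] at hw
  have h1 : Tendsto (fun l => ‖V (G l)‖ * ‖w‖) atTop (𝓝 0) := by simpa using hVG0.mul_const ‖w‖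
  obtain ⟨N, hN⟩ := eventually_atTop.mp (h1.eventually_lt_const (half_pos hε))
  refine ⟨N, fun l hl => ?_⟩
  rw [dist_zero_right, hint l]
  have hsplit : inner ℝ (G l) (hv.toLp v) =
      inner ℝ (G l) (hv.toLp v - ContinuousLinearMap.adjoint V w) + inner ℝ (V (G l)) w := by
    rw [inner_sub_right, ContinuousLinearMap.adjoint_inner_right]
    ring
  rw [hsplit]
  have h2 : ‖inner ℝ (G l) (hv.toLp v - ContinuousLinearMap.adjoint V w)‖ ≤ ε / 2 := by
    refine (norm_inner_le_norm _ _).trans ?_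
    calc ‖G l‖ * ‖hv.toLp v - ContinuousLinearMap.adjoint V w‖
        ≤ (M + 1) * (ε / (2 * (M + 1))) := by
          gcongr
          linarith [hG l]
      _ = ε / 2 := by field_simp
  have h3 := norm_inner_le_norm (𝕜 := ℝ) (V (G l)) w
  have h4 := hN l hl.le
  exact (norm_add_le _ _).trans_lt (by linarith)

/-- An asymptotically invariant bounded sequence of functions has asymptotically the same mean
under `μ` and under any absolutely continuous probability measure. -/
theorem tendsto_integral_sub_integral (hT : Ergodic T μ) {g : ℕ → X → ℝ}
    (hg : ∀ l, Measurable (g l)) {M : ℝ} (hM : ∀ l x, |g l x| ≤ M)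
    (hinv : Tendsto (fun l => ∫ x, |g l (T x) - g l x| ∂μ) atTop (𝓝 0))
    {ν : Measure X} [IsProbabilityMeasure ν] (hν : ν ≪ μ) :
    Tendsto (fun l => ∫ x, g l x ∂ν - ∫ x, g l x ∂μ) atTop (𝓝 0) := by
  have hM0 : 0 ≤ M := by
    have : Nonempty X := Measure.nonempty_of_neZero μ
    exact (abs_nonneg _).trans (hM 0 (Classical.arbitrary X))
  set p : X → ℝ := fun x => (ν.rnDeriv μ x).toReal with hp
  have hpint : Integrable p μ := Measure.integrable_toReal_rnDeriv
  have hp1 : ∫ x, p x ∂μ = 1 := by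
    rw [hp, Measure.integral_toReal_rnDeriv hν]
    simp
  rw [Metric.tendsto_atTop']
  intro ε hε
  set δ := ε / (4 * (M + 1)) with hδ
  have hδ0 : 0 < δ := by positivity
  -- The density `p` is only in `L¹`; a simple function brings the problem into `L²`. Its mean `m`
  -- is merely close to `1`, so `s - m` is the mean-zero function used below.
  obtain ⟨s, hs, hsL⟩ := (memLp_one_iff_integrable.mpr hpint).exists_simpleFunc_eLpNorm_sub_lt
    ENNReal.one_ne_top (ε := ENNReal.ofReal δ) (by simpa using hδ0)
  have hsint : Integrable s μ := memLp_one_iff_integrable.mp hsL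
  have hps : ∫ x, |p x - s x| ∂μ < δ := by
    have h1 : Integrable (p - ⇑s) μ := hpint.sub hsint
    rw [eLpNorm_one_eq_lintegral_enorm, ← ofReal_integral_norm_eq_lintegral_enorm h1,
      ENNReal.ofReal_lt_ofReal_iff hδ0] at hs
    simpa using hs
  have hs2 : MemLp s 2 μ := SimpleFunc.memLp_of_isFiniteMeasure s 2 μ
  set m := ∫ x, s x ∂μ with hm
  have hm1 : |m - 1| ≤ δ := by
    rw [hm, ← hp1, ← integral_sub hsint hpint]
    refine (abs_integral_le_integral_abs).trans ?_
    simp_rw [abs_sub_comm (s _)]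
    exact hps.le
  have hlim := tendsto_integral_mul_of_asymptotically_invariant hT hg hM hinv
    (v := fun x => s x - m) (hs2.sub (memLp_const m))
    (by rw [integral_sub hsint (integrable_const m)]; simp [hm])
  obtain ⟨N, hN⟩ := (Metric.tendsto_atTop'.mp hlim) (ε / 2) (half_pos hε)
  refine ⟨N, fun l hl => ?_⟩
  have hgb : ∀ᵐ x ∂μ, ‖g l x‖ ≤ M := Eventually.of_forall fun x => hM l x
  have hgi : Integrable (g l) μ := Integrable.of_bound (hg l).aestronglyMeasurable M hgb
  have hgs : Integrable (fun x => g l x * s x) μ :=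
    hsint.bdd_mul (hg l).aestronglyMeasurable hgb
  have hgp : Integrable (fun x => g l x * p x) μ :=
    hpint.bdd_mul (hg l).aestronglyMeasurable hgb
  have e1 : ∫ x, g l x ∂ν = ∫ x, g l x * p x ∂μ := by
    rw [← integral_rnDeriv_smul hν]
    simp [hp, mul_comm]
  have e2 : ∫ x, g l x * (s x - m) ∂μ = ∫ x, g l x * s x ∂μ - m * ∫ x, g l x ∂μ := by
    simp_rw [mul_sub]
    rw [integral_sub hgs (hgi.mul_const m), integral_mul_const, mul_comm m]
  have e3 : |∫ x, g l x * p x ∂μ - ∫ x, g l x * s x ∂μ| ≤ M * δ := by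
    rw [← integral_sub hgp hgs]
    refine (abs_integral_le_integral_abs).trans ?_
    calc ∫ x, |g l x * p x - g l x * s x| ∂μ ≤ ∫ x, M * |p x - s x| ∂μ := by
          refine integral_mono (hgp.sub hgs).abs ((hpint.sub hsint).abs.const_mul M) fun x => ?_
          simp only [← mul_sub, abs_mul]
          exact mul_le_mul_of_nonneg_right (hM l x) (abs_nonneg _)
      _ ≤ M * δ := by
          rw [integral_const_mul]
          gcongr
  have e4 : |(m - 1) * ∫ x, g l x ∂μ| ≤ δ * M := by
    rw [abs_mul]
    gcongr
    have := norm_integral_le_of_norm_le_const hgb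
    simpa using this
  have e5 := hN l hl
  rw [dist_zero_right, Real.norm_eq_abs, e2] at e5
  rw [dist_zero_right, Real.norm_eq_abs, e1]
  have e6 : M * δ + δ * M ≤ ε / 2 := by
    have : (M + 1) * δ = ε / 4 := by rw [hδ]; field_simp
    nlinarith
  rw [abs_lt] at e5 ⊢
  rw [abs_le] at e3 e4
  constructor <;> nlinarith [e3.1, e3.2, e4.1, e4.2]

/-- With the factor `2`, `dist` dominates the `L¹` distance of the densities: splitting at `B = {q ≤
p}`, both halves of `∫ |p - q|` equal `ν(B) - ν'(B)`. -/
theorem abs_integral_sub_le_mul_tvDist {g : X → ℝ} (hg : Measurable g) {M : ℝ}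
    (hM : ∀ x, |g x| ≤ M) (ν ν' : AbsContProb μ) :
    |∫ x, g x ∂ν.toMeasure - ∫ x, g x ∂ν'.toMeasure| ≤ M * dist ν ν' := by
  have := ν.isProb
  have := ν'.isProb
  have hM0 : 0 ≤ M := by
    have : Nonempty X := Measure.nonempty_of_neZero μ
    exact (abs_nonneg _).trans (hM (Classical.arbitrary X))
  set p : X → ℝ := fun x => (ν.toMeasure.rnDeriv μ x).toReal with hp
  set q : X → ℝ := fun x => (ν'.toMeasure.rnDeriv μ x).toReal with hq
  have hpi : Integrable p μ := Measure.integrable_toReal_rnDeriv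
  have hqi : Integrable q μ := Measure.integrable_toReal_rnDeriv
  have hpm : Measurable p := (Measure.measurable_rnDeriv _ _).ennreal_toReal
  have hqm : Measurable q := (Measure.measurable_rnDeriv _ _).ennreal_toReal
  have hgb : ∀ᵐ x ∂μ, ‖g x‖ ≤ M := Eventually.of_forall fun x => hM x
  have e1 : ∫ x, g x ∂ν.toMeasure = ∫ x, g x * p x ∂μ := by
    rw [← integral_rnDeriv_smul ν.absCont]
    simp [hp, mul_comm]
  have e2 : ∫ x, g x ∂ν'.toMeasure = ∫ x, g x * q x ∂μ := by
    rw [← integral_rnDeriv_smul ν'.absCont]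
    simp [hq, mul_comm]
  have hgp : Integrable (fun x => g x * p x) μ := hpi.bdd_mul hg.aestronglyMeasurable hgb
  have hgq : Integrable (fun x => g x * q x) μ := hqi.bdd_mul hg.aestronglyMeasurable hgb
  have e3 : ∫ x, |p x - q x| ∂μ ≤ dist ν ν' := by
    let B : Set X := {x | q x ≤ p x}
    have hB : MeasurableSet B := measurableSet_le hqm hpm
    rw [← integral_add_compl (f := fun x => |p x - q x|) hB (hpi.sub hqi).abs]
    have h1 : ∫ x in B, |p x - q x| ∂μ = ν.toMeasure.real B - ν'.toMeasure.real B := by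
      rw [← Measure.setIntegral_toReal_rnDeriv ν.absCont B,
        ← Measure.setIntegral_toReal_rnDeriv ν'.absCont B,
        ← integral_sub hpi.integrableOn hqi.integrableOn]
      refine setIntegral_congr_fun hB fun x hx => ?_
      exact abs_of_nonneg (sub_nonneg.mpr hx)
    have h2 : ∫ x in Bᶜ, |p x - q x| ∂μ = ν'.toMeasure.real Bᶜ - ν.toMeasure.real Bᶜ := by
      rw [← Measure.setIntegral_toReal_rnDeriv ν.absCont Bᶜ,
        ← Measure.setIntegral_toReal_rnDeriv ν'.absCont Bᶜ,
        ← integral_sub hqi.integrableOn hpi.integrableOn]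
      refine setIntegral_congr_fun hB.compl fun x hx => ?_
      have hx' : p x < q x := not_le.mp hx
      change |p x - q x| = q x - p x
      rw [abs_of_neg (sub_neg.mpr hx'), neg_sub]
    rw [h1, h2, probReal_compl_eq_one_sub hB, probReal_compl_eq_one_sub hB]
    have := AbsContProb.abs_sub_le_tvDist ν ν' hB
    have h3 := le_abs_self (ν.toMeasure.real B - ν'.toMeasure.real B)
    change _ ≤ AbsContProb.tvDist ν ν'
    linarith
  rw [e1, e2, ← integral_sub hgp hgq]
  refine (abs_integral_le_integral_abs).trans ?_
  calc ∫ x, |g x * p x - g x * q x| ∂μ ≤ ∫ x, M * |p x - q x| ∂μ := by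
        refine integral_mono (hgp.sub hgq).abs ((hpi.sub hqi).abs.const_mul M) fun x => ?_
        simp only [← mul_sub, abs_mul]
        exact mul_le_mul_of_nonneg_right (hM x) (abs_nonneg _)
    _ ≤ M * dist ν ν' := by
        rw [integral_const_mul]
        gcongr

/-- The convergence of `tendsto_integral_sub_integral` is uniform on compact sets of
measures. -/
theorem tendsto_integral_sub_integral_of_isCompact (hT : Ergodic T μ) {g : ℕ → X → ℝ}
    (hg : ∀ l, Measurable (g l)) {M : ℝ} (hM : ∀ l x, |g l x| ≤ M)
    (hinv : Tendsto (fun l => ∫ x, |g l (T x) - g l x| ∂μ) atTop (𝓝 0))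
    {K : Set (AbsContProb μ)} (hK : IsCompact K) {ν : ℕ → AbsContProb μ} (hν : ∀ l, ν l ∈ K) :
    Tendsto (fun l => ∫ x, g l x ∂(ν l).toMeasure - ∫ x, g l x ∂μ) atTop (𝓝 0) := by
  have hM0 : 0 ≤ M := by
    have : Nonempty X := Measure.nonempty_of_neZero μ
    exact (abs_nonneg _).trans (hM 0 (Classical.arbitrary X))
  rw [Metric.tendsto_atTop']
  intro ε hε
  -- A finite net reduces uniformity over `K` to finitely many fixed measures.
  obtain ⟨t, -, ht, hcov⟩ := hK.finite_cover_balls (e := ε / (2 * (M + 1))) (by positivity)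
  have hev : ∀ᶠ l in atTop, ∀ ν₀ ∈ t,
      |∫ x, g l x ∂ν₀.toMeasure - ∫ x, g l x ∂μ| < ε / 2 := by
    rw [ht.eventually_all]
    intro ν₀ _
    have := ν₀.isProb
    have h := tendsto_integral_sub_integral hT hg hM hinv ν₀.absCont
    simpa [Real.dist_eq] using (Metric.tendsto_nhds.mp h) (ε / 2) (half_pos hε)
  obtain ⟨N, hN⟩ := eventually_atTop.mp hev
  refine ⟨N, fun l hl => ?_⟩
  obtain ⟨ν₀, hν₀, hd⟩ := Set.mem_iUnion₂.mp (hcov (hν l))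
  have h1 := hN l hl.le ν₀ hν₀
  have h2 := abs_integral_sub_le_mul_tvDist (hg l) (hM l) (ν l) ν₀
  have h3 : M * dist (ν l) ν₀ ≤ ε / 2 := by
    calc M * dist (ν l) ν₀ ≤ (M + 1) * (ε / (2 * (M + 1))) := by
          gcongr
          · linarith
          · exact (Metric.mem_ball.mp hd).le
      _ = ε / 2 := by field_simp
  rw [dist_zero_right, Real.norm_eq_abs]
  have h4 := abs_sub_le (∫ x, g l x ∂(ν l).toMeasure) (∫ x, g l x ∂ν₀.toMeasure) (∫ x, g l x ∂μ)
  linarith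

end StrongConvergence

/-! ### Renewal identities and the induced map -/

section Kac

variable {X : Type*} {T : X → X} {A : Set X}

/-- One-step decomposition: the first step costs a factor `e^{-c}`, then the orbit has either
entered `A` or starts afresh at `T x`. Since `c ≠ 0`, both sides vanish when the hitting time is
infinite. -/
theorem expNeg_mul_hitTime_mul_comp_entranceMap {c : ℝ≥0∞} (hc : c ≠ 0) (b : X → ℝ) (x : X) :
    expNeg (c * (hitTime T A x : ℝ≥0∞)) * b (entranceMap T A x) =
      expNeg c * (A.indicator b (T x) + Aᶜ.indicator
        (fun y => expNeg (c * (hitTime T A y : ℝ≥0∞)) * b (entranceMap T A y)) (T x)) := by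
  by_cases h : T x ∈ A
  · simp [hitTime_of_mem h, entranceMap_of_mem h, h]
  · by_cases h2 : hitTime T A (T x) = ⊤
    · simp [hitTime_of_notMem h, h, h2, ENNReal.mul_top hc]
    · simp only [hitTime_of_notMem h, entranceMap_of_notMem h h2, Set.indicator, h, if_false,
        Set.mem_compl_iff, not_false_eq_true, if_true, ENat.toENNReal_add, mul_add,
        ENat.toENNReal_one, mul_one, expNeg_add]
      ring

variable [MeasurableSpace X] {μ : Measure X}

theorem integral_cond_eq (A : Set X) (b : X → ℝ) :
    ∫ x, b x ∂μ[|A] = (μ.real A)⁻¹ * ∫ x in A, b x ∂μ := by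
  rw [ProbabilityTheory.cond, integral_smul_measure, ENNReal.toReal_inv, smul_eq_mul]
  rfl

variable [IsFiniteMeasure μ]

theorem measurable_expNeg_mul_hitTime (hT : Measurable T) (hA : MeasurableSet A) (c : ℝ≥0∞) :
    Measurable fun x => expNeg (c * (hitTime T A x : ℝ≥0∞)) :=
  continuous_expNeg.measurable.comp (((Measurable.of_discrete (f := ENat.toENNReal)).comp
    (measurable_hitTime hT hA)).const_mul c)

theorem integrable_expNeg_mul_hitTime_mul (hT : Measurable T) (hA : MeasurableSet A) (c : ℝ≥0∞)
    {b : X → ℝ} (hb : Measurable b) {M : ℝ} (hM : ∀ x, |b x| ≤ M) :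
    Integrable (fun x => expNeg (c * (hitTime T A x : ℝ≥0∞)) * b (entranceMap T A x)) μ := by
  refine Integrable.of_bound ((measurable_expNeg_mul_hitTime hT hA c).mul
    (hb.comp (measurable_entranceMap hT hA))).aestronglyMeasurable M
    (Eventually.of_forall fun x => ?_)
  rw [norm_mul, Real.norm_eq_abs, Real.norm_eq_abs]
  exact (mul_le_of_le_one_left (abs_nonneg _) (abs_expNeg_le_one _)).trans (hM _)

/-- A renewal identity for the joint Laplace transform of the hitting time and the entrance
point. -/
theorem integral_expNeg_mul_hitTime_mul (hT : MeasurePreserving T μ μ) (hA : MeasurableSet A)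
    {c : ℝ≥0∞} (hc : c ≠ 0) {b : X → ℝ} (hb : Measurable b) {M : ℝ} (hM : ∀ x, |b x| ≤ M) :
    ∫ x, expNeg (c * (hitTime T A x : ℝ≥0∞)) * b (entranceMap T A x) ∂μ =
      expNeg c * (∫ x in A, b x ∂μ +
        ∫ x, expNeg (c * (hitTime T A x : ℝ≥0∞)) * b (entranceMap T A x) ∂μ -
        ∫ x in A, expNeg (c * (hitTime T A x : ℝ≥0∞)) * b (entranceMap T A x) ∂μ) := by
  set v : X → ℝ := fun x => expNeg (c * (hitTime T A x : ℝ≥0∞)) * b (entranceMap T A x) with hv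
  have hvi : Integrable v μ := integrable_expNeg_mul_hitTime_mul hT.measurable hA c hb hM
  have hbi : Integrable b μ :=
    Integrable.of_bound hb.aestronglyMeasurable M (Eventually.of_forall fun x => hM x)
  have hsum : Integrable (fun x => A.indicator b x + Aᶜ.indicator v x) μ :=
    (hbi.indicator hA).add (hvi.indicator hA.compl)
  have e1 : ∫ x, v x ∂μ = ∫ x, expNeg c * (A.indicator b (T x) + Aᶜ.indicator v (T x)) ∂μ :=
    integral_congr_ae (Eventually.of_forall fun x =>
      expNeg_mul_hitTime_mul_comp_entranceMap hc b x)
  have e2 : ∫ x, (A.indicator b (T x) + Aᶜ.indicator v (T x)) ∂μ =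
      ∫ x, (A.indicator b x + Aᶜ.indicator v x) ∂μ := by
    have h := integral_map (μ := μ) hT.measurable.aemeasurable
      (f := fun x => A.indicator b x + Aᶜ.indicator v x) (by rw [hT.map_eq]; exact hsum.1)
    rw [hT.map_eq] at h
    exact h.symm
  rw [integral_const_mul, e2, integral_add (hbi.indicator hA) (hvi.indicator hA.compl),
    integral_indicator hA, integral_indicator hA.compl] at e1
  rw [add_sub_assoc, ← integral_add_compl hA hvi, add_sub_cancel_left, integral_add_compl hA hvi]
  exact e1

/-- The induced map `T_A` preserves the restriction of `μ` to `A`. -/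
theorem setIntegral_comp_entranceMap (hT : MeasurePreserving T μ μ) (hA : MeasurableSet A)
    (hfin : ∀ᵐ x ∂μ, hitTime T A x ≠ ⊤) {b : X → ℝ} (hb : Measurable b) {M : ℝ}
    (hM : ∀ x, |b x| ≤ M) :
    ∫ x in A, b (entranceMap T A x) ∂μ = ∫ x in A, b x ∂μ := by
  -- As `c → 0` the renewal identity tends to `I = ∫_A b + I - ∫_A b ∘ T_A`, and `I` cancels. The
  -- value `c 0 = ⊤` is harmless, being nonzero.
  let c : ℕ → ℝ≥0∞ := fun n => (n : ℝ≥0∞)⁻¹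
  have hc0 : ∀ n, c n ≠ 0 := fun n => by simp [c]
  have hc : Tendsto c atTop (𝓝 0) := ENNReal.tendsto_inv_nat_nhds_zero
  have hq : Tendsto (fun n => expNeg (c n)) atTop (𝓝 1) := by
    simpa [Function.comp_def] using (continuous_expNeg.tendsto 0).comp hc
  have hlim : ∀ s : Set X, Tendsto
      (fun n => ∫ x in s, expNeg (c n * (hitTime T A x : ℝ≥0∞)) * b (entranceMap T A x) ∂μ)
      atTop (𝓝 (∫ x in s, b (entranceMap T A x) ∂μ)) := by
    intro s
    refine tendsto_integral_of_dominated_convergence (fun _ => M) (fun n =>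
      (integrable_expNeg_mul_hitTime_mul hT.measurable hA (c n) hb hM).1.restrict)
      (integrable_const M) (fun n => Eventually.of_forall fun x => ?_) ?_
    · rw [norm_mul, Real.norm_eq_abs, Real.norm_eq_abs]
      exact (mul_le_of_le_one_left (abs_nonneg _) (abs_expNeg_le_one _)).trans (hM _)
    · filter_upwards [ae_restrict_of_ae hfin] with x hx
      have h1 : Tendsto (fun n => c n * (hitTime T A x : ℝ≥0∞)) atTop (𝓝 0) := by
        have := ENNReal.Tendsto.mul_const (b := (hitTime T A x : ℝ≥0∞)) hc
          (Or.inr (by simpa using hx))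
        simpa using this
      have h2 := (continuous_expNeg.tendsto 0).comp h1
      simpa using h2.mul_const (b (entranceMap T A x))
  have h1 := hlim Set.univ
  simp only [Measure.restrict_univ] at h1
  have h2 := hq.mul ((h1.const_add (∫ x in A, b x ∂μ)).sub (hlim A))
  have h3 := tendsto_nhds_unique h1 (h2.congr fun n =>
    (integral_expNeg_mul_hitTime_mul hT hA (hc0 n) hb hM).symm)
  linarith

theorem integral_cond_comp_entranceMap (hT : MeasurePreserving T μ μ) (hA : MeasurableSet A)
    (hfin : ∀ᵐ x ∂μ, hitTime T A x ≠ ⊤) {b : X → ℝ} (hb : Measurable b) {M : ℝ}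
    (hM : ∀ x, |b x| ≤ M) :
    ∫ x, b (entranceMap T A x) ∂μ[|A] = ∫ x, b x ∂μ[|A] := by
  rw [integral_cond_eq, integral_cond_eq, setIntegral_comp_entranceMap hT hA hfin hb hM]

/-- The relation between the Laplace transforms of the hitting time and of the return time. -/
theorem integral_expNeg_mul_hitTime (hT : MeasurePreserving T μ μ) (hA : MeasurableSet A)
    (hpos : 0 < μ A) :
    (Real.exp (μ.real A) - 1) * ∫ x, expNeg (μ A * (hitTime T A x : ℝ≥0∞)) ∂μ =
      μ.real A * (1 - ∫ x, expNeg (μ A * (hitTime T A x : ℝ≥0∞)) ∂μ[|A]) := by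
  have h := integral_expNeg_mul_hitTime_mul hT hA hpos.ne' (b := fun _ => 1) measurable_const
    (M := 1) (by simp)
  have hreal : μ.real A ≠ 0 := (ENNReal.toReal_pos hpos.ne' (measure_ne_top μ A)).ne'
  simp only [mul_one, setIntegral_const, smul_eq_mul, expNeg_eq_exp (measure_ne_top μ A)] at h
  change _ = Real.exp (-μ.real A) * _ at h
  rw [integral_cond_eq, mul_sub, mul_inv_cancel_left₀ hreal]
  have h2 : Real.exp (μ.real A) * Real.exp (-μ.real A) = 1 := by
    rw [← Real.exp_add]; simp
  rw [sub_mul, h, ← mul_assoc, h2, ← h]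
  ring

theorem tendsto_div_exp_sub_one : Tendsto (fun t : ℝ => t / (Real.exp t - 1)) (𝓝[≠] 0) (𝓝 1) := by
  have h := (hasDerivAt_iff_tendsto_slope_zero.mp (Real.hasDerivAt_exp 0)).inv₀ (by simp)
  simpa [div_eq_mul_inv, mul_comm] using h

/-- The value `1/2 = E[e^{-Y}]`, for an exponential variable `Y`, is attained in the limit by the
normalized hitting times if and only if it is attained by the normalized return times. -/
theorem tendsto_integral_expNeg_half_iff {A : ℕ → Set X} (hT : MeasurePreserving T μ μ)
    (hA : ∀ l, MeasurableSet (A l)) (hpos : ∀ l, 0 < μ (A l))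
    (hrare : Tendsto (fun l => μ (A l)) atTop (𝓝 0)) :
    Tendsto (fun l => ∫ x, expNeg (μ (A l) * (hitTime T (A l) x : ℝ≥0∞)) ∂μ) atTop (𝓝 (1 / 2)) ↔
      Tendsto (fun l => ∫ x, expNeg (μ (A l) * (hitTime T (A l) x : ℝ≥0∞)) ∂μ[|A l]) atTop
        (𝓝 (1 / 2)) := by
  have hreal : ∀ l, 0 < μ.real (A l) := fun l =>
    ENNReal.toReal_pos (hpos l).ne' (measure_ne_top μ _)
  have h0 : Tendsto (fun l => μ.real (A l)) atTop (𝓝 0) := by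
    simpa [Function.comp_def, measureReal_def] using
      (ENNReal.tendsto_toReal ENNReal.zero_ne_top).comp hrare
  -- With this ratio tending to `1`, the identity becomes "hitting value = 1 - return value" in the
  -- limit.
  have hr : Tendsto (fun l => μ.real (A l) / (Real.exp (μ.real (A l)) - 1)) atTop (𝓝 1) :=
    tendsto_div_exp_sub_one.comp (tendsto_nhdsWithin_iff.mpr
      ⟨h0, Eventually.of_forall fun l => (hreal l).ne'⟩)
  have hexp : ∀ l, 0 < Real.exp (μ.real (A l)) - 1 := fun l => by
    have := Real.add_one_lt_exp (hreal l).ne'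
    linarith [hreal l]
  have hrel := fun l => integral_expNeg_mul_hitTime hT (hA l) (hpos l)
  constructor <;> intro h
  · have h1 := (h.div hr one_ne_zero).const_sub 1
    have h2 : (1 : ℝ) - 1 / 2 / 1 = 1 / 2 := by norm_num
    rw [h2] at h1
    refine h1.congr fun l => ?_
    have e := hrel l
    have := (hexp l).ne'
    have := (hreal l).ne'
    simp only [Pi.div_apply]
    field_simp
    linear_combination -e
  · have h1 := hr.mul (h.const_sub 1)
    have h2 : (1 : ℝ) * (1 - 1 / 2) = 1 / 2 := by norm_num
    rw [h2] at h1
    refine h1.congr fun l => ?_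
    have e := hrel l
    have := (hexp l).ne'
    field_simp
    linear_combination -e

end Kac

/-! ### The exponential Laplace value and control of path functionals -/

theorem integral_expNeg_ofReal_expMeasure :
    ∫ x, expNeg (ENNReal.ofReal x) ∂expMeasure 1 = 1 / 2 := by
  have h1 : expMeasure 1 = volume.withDensity (exponentialPDF 1) := rfl
  have hm : Measurable (exponentialPDF 1) := (measurable_exponentialPDFReal 1).ennreal_ofReal
  rw [h1, integral_withDensity_eq_integral_toReal_smul hm
    (Eventually.of_forall fun x => ENNReal.ofReal_lt_top)]
  have h2 : ∀ x : ℝ, (exponentialPDF 1 x).toReal • expNeg (ENNReal.ofReal x) =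
      (Set.Ici 0).indicator (fun x : ℝ => Real.exp (-2 * x)) x := by
    intro x
    by_cases hx : 0 ≤ x
    · rw [exponentialPDF_of_nonneg hx, expNeg_ofReal hx,
        ENNReal.toReal_ofReal (by positivity), Set.indicator_of_mem (Set.mem_Ici.mpr hx),
        smul_eq_mul, one_mul, one_mul, ← Real.exp_add]
      ring_nf
    · rw [exponentialPDF_of_neg (not_le.mp hx), Set.indicator_of_notMem (by simpa using hx)]
      simp
  simp_rw [h2]
  rw [integral_indicator measurableSet_Ici, integral_Ici_eq_integral_Ioi,
    integral_exp_mul_Ioi (by norm_num)]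
  norm_num

/-- The null sequence may depend on `δ`, as it does when it contains the constant `C` attached to
`δ`. -/
theorem tendsto_zero_of_forall_abs_le_add {d : ℕ → ℝ}
    (h : ∀ δ > 0, ∃ u : ℕ → ℝ, Tendsto u atTop (𝓝 0) ∧ ∀ l, |d l| ≤ δ + u l) :
    Tendsto d atTop (𝓝 0) := by
  rw [Metric.tendsto_nhds]
  intro ε hε
  obtain ⟨u, hu, hle⟩ := h (ε / 2) (half_pos hε)
  filter_upwards [hu.eventually_lt_const (half_pos hε)] with l hl
  rw [dist_zero_right, Real.norm_eq_abs]
  linarith [hle l]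

section Processes

variable {F : Type*} [TopologicalSpace F] [CompactSpace F]

/-- A continuous function on the path space is controlled by the initial waiting times when all
the other coordinates agree. -/
theorem exists_abs_sub_le_of_eq_succ (f : C((ℕ → ℝ≥0∞) × (ℕ → F), ℝ)) {δ : ℝ} (hδ : 0 < δ) :
    ∃ C : ℝ, 0 ≤ C ∧ ∀ y z : (ℕ → ℝ≥0∞) × (ℕ → F), (∀ j, y.1 (j + 1) = z.1 (j + 1)) →
      y.2 = z.2 → |f y - f z| ≤ δ + C * |expNeg (y.1 0) - expNeg (z.1 0)| := by
  -- Overwriting coordinate `0` exhibits `f` as a function of the first waiting time and a compact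
  -- remainder.
  obtain ⟨C, hC0, hC⟩ := exists_abs_sub_le_add_mul_expNeg
    (f.comp ⟨fun p : ℝ≥0∞ × ((ℕ → ℝ≥0∞) × (ℕ → F)) => (Function.update p.2.1 0 p.1, p.2.2),
      by fun_prop⟩) hδ
  refine ⟨C, hC0, fun y z h1 h2 => ?_⟩
  have h := hC (y.1 0) (z.1 0) z
  have e : (Function.update z.1 0 (y.1 0), z.2) = y := by
    refine Prod.ext (funext fun j => ?_) h2.symm
    cases j with
    | zero => simp
    | succ j => simp [h1 j]
  simpa [e] using h

end Processes

section Congr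

variable {X : Type*} {T : X → X} {A : Set X} {x y : X}

theorem hitProcess_succ_congr [MeasurableSpace X] {μ : Measure X}
    (h : entranceMap T A y = entranceMap T A x) (j : ℕ) :
    hitProcess μ T A y (j + 1) = hitProcess μ T A x (j + 1) := by
  simp only [hitProcess, Function.iterate_succ_apply, h]

theorem localProcess_congr {F : Type*} [Nonempty F] {ψ : A → F}
    (h : entranceMap T A y = entranceMap T A x) : localProcess T ψ y = localProcess T ψ x := by
  funext j
  simp only [localProcess, Function.iterate_succ_apply, h]

end Congr

/-! ### Comparison of the joint processes under `μ` and `μ_A` -/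

section JointProcesses

variable {X : Type*} [MeasurableSpace X] {μ : Measure X} {T : X → X}
  {A : ℕ → Set X} {F : Type*} [MetricSpace F] [CompactSpace F] [MeasurableSpace F] [BorelSpace F]
  [Nonempty F] {ψ : ∀ l, A l → F}

theorem measurable_comp_jointProcess (hT : Measurable T) (hA : ∀ l, MeasurableSet (A l))
    (hψ : ∀ l, Measurable (ψ l)) (f : C((ℕ → ℝ≥0∞) × (ℕ → F), ℝ)) (l : ℕ) :
    Measurable fun x => f (hitProcess μ T (A l) x, localProcess T (ψ l) x) :=
  f.continuous.measurable.comp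
    ((measurable_hitProcess hT (hA l)).prodMk (measurable_localProcess hT (hA l) (hψ l)))

variable [IsProbabilityMeasure μ]

/-- The joint processes are asymptotically invariant. -/
theorem tendsto_integral_abs_jointProcess_comp_sub (hT : Ergodic T μ)
    (hA : ∀ l, MeasurableSet (A l)) (hpos : ∀ l, 0 < μ (A l))
    (hrare : Tendsto (fun l => μ (A l)) atTop (𝓝 0)) (hψ : ∀ l, Measurable (ψ l))
    (f : C((ℕ → ℝ≥0∞) × (ℕ → F), ℝ)) :
    Tendsto (fun l => ∫ x, |f (hitProcess μ T (A l) (T x), localProcess T (ψ l) (T x)) -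
      f (hitProcess μ T (A l) x, localProcess T (ψ l) x)| ∂μ) atTop (𝓝 0) := by
  refine tendsto_zero_of_forall_abs_le_add fun δ hδ => ?_
  obtain ⟨C, hC0, hC⟩ := exists_abs_sub_le_of_eq_succ f hδ
  -- The first term is the shift of the initial waiting time by `μ(A)`; the second is the crude
  -- bound on `T⁻¹ A`, a set of measure `μ(A)`.
  refine ⟨fun l => C * (1 - expNeg (μ (A l))) + 2 * ‖f‖ * μ.real (A l), ?_, fun l => ?_⟩
  · have h1 : Tendsto (fun l => expNeg (μ (A l))) atTop (𝓝 1) := by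
      simpa [Function.comp_def] using (continuous_expNeg.tendsto 0).comp hrare
    have h2 : Tendsto (fun l => μ.real (A l)) atTop (𝓝 0) := by
      simpa [Function.comp_def, measureReal_def] using
        (ENNReal.tendsto_toReal ENNReal.zero_ne_top).comp hrare
    simpa using ((h1.const_sub 1).const_mul C).add (h2.const_mul (2 * ‖f‖))
  · have hm := measurable_comp_jointProcess (μ := μ) hT.measurable hA hψ f l
    have hb : ∀ y z, |f y - f z| ≤ 2 * ‖f‖ := fun y z => by
      refine (abs_sub _ _).trans ?_
      linarith [f.norm_coe_le_norm y, f.norm_coe_le_norm z, Real.norm_eq_abs (f y),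
        Real.norm_eq_abs (f z)]
    rw [abs_of_nonneg (integral_nonneg fun x => abs_nonneg _)]
    have hle : ∀ᵐ x ∂μ, |f (hitProcess μ T (A l) (T x), localProcess T (ψ l) (T x)) -
        f (hitProcess μ T (A l) x, localProcess T (ψ l) x)| ≤
        δ + C * (1 - expNeg (μ (A l))) + (T ⁻¹' A l).indicator (fun _ => 2 * ‖f‖) x := by
      have hq : 0 ≤ C * (1 - expNeg (μ (A l))) :=
        mul_nonneg hC0 (sub_nonneg.mpr (expNeg_le_one _))
      filter_upwards [ae_hitTime_ne_top hT (hA l) (hpos l)] with x hx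
      by_cases h : T x ∈ A l
      · rw [Set.indicator_of_mem (by exact h)]
        linarith [hb (hitProcess μ T (A l) (T x), localProcess T (ψ l) (T x))
          (hitProcess μ T (A l) x, localProcess T (ψ l) x)]
      · rw [Set.indicator_of_notMem (by exact h), add_zero]
        have hφ := hitTime_of_notMem h
        have hx' : hitTime T (A l) (T x) ≠ ⊤ := fun h' => hx (by rw [hφ, h']; simp)
        have he := entranceMap_of_notMem h hx'
        refine (hC _ _ (hitProcess_succ_congr he.symm) (localProcess_congr he.symm)).trans ?_
        gcongr
        simp only [hitProcess, Function.iterate_zero, id, hφ, ENat.toENNReal_add,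
          ENat.toENNReal_one, mul_add, mul_one, expNeg_add]
        rw [← mul_one_sub, abs_mul, abs_of_nonneg (sub_nonneg.mpr (expNeg_le_one (μ (A l))))]
        exact mul_le_of_le_one_left (sub_nonneg.mpr (expNeg_le_one _)) (abs_expNeg_le_one _)
    have hTA : MeasurableSet (T ⁻¹' A l) := hT.measurable (hA l)
    have hind : Integrable ((T ⁻¹' A l).indicator fun _ => 2 * ‖f‖) μ :=
      (integrable_const _).indicator hTA
    refine (integral_mono_ae (Integrable.of_bound
      ((hm.comp hT.measurable).sub hm).abs.aestronglyMeasurable (2 * ‖f‖)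
      (Eventually.of_forall fun x => by simpa using hb _ _))
      ((integrable_const _).add hind) hle).trans ?_
    rw [integral_add' (integrable_const _) hind, integral_indicator_const _ hTA]
    rw [hT.toMeasurePreserving.measureReal_preimage (hA l).nullMeasurableSet]
    simp only [integral_const, probReal_univ, smul_eq_mul]
    linarith

/-- If hitting times and return times have asymptotically the same Laplace transform, then the
joint processes have asymptotically the same law under `μ` as under the conditional measures. -/
theorem tendsto_integral_cond_sub_integral (hT : Ergodic T μ)
    (hA : ∀ l, MeasurableSet (A l)) (hpos : ∀ l, 0 < μ (A l))
    (hrare : Tendsto (fun l => μ (A l)) atTop (𝓝 0)) (hψ : ∀ l, Measurable (ψ l))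
    {τ : ℕ → X → ℕ} (hτ : ∀ l, Measurable (τ l))
    (hτ_lt : Tendsto (fun l => μ[|A l] {x | (τ l x : ℕ∞) < hitTime T (A l) x}) atTop (𝓝 1))
    {K : Set (AbsContProb μ)} (hK : IsCompact K)
    (hτ_K : ∀ l, ∃ ν ∈ K, ν.toMeasure = (μ[|A l]).map (timeMap T (τ l)))
    (hlap : Tendsto (fun l => ∫ x, expNeg (μ (A l) * (hitTime T (A l) x : ℝ≥0∞)) ∂μ -
      ∫ x, expNeg (μ (A l) * (hitTime T (A l) x : ℝ≥0∞)) ∂μ[|A l]) atTop (𝓝 0))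
    (f : C((ℕ → ℝ≥0∞) × (ℕ → F), ℝ)) :
    Tendsto (fun l => ∫ x, f (hitProcess μ T (A l) x, localProcess T (ψ l) x) ∂μ[|A l] -
      ∫ x, f (hitProcess μ T (A l) x, localProcess T (ψ l) x) ∂μ) atTop (𝓝 0) := by
  have hprob : ∀ l, IsProbabilityMeasure (μ[|A l]) :=
    fun l => cond_isProbabilityMeasure (hpos l).ne'
  choose ν hνK hν using hτ_K
  have hTm := hT.measurable
  have hθ : ∀ l, Measurable (timeMap T (τ l)) := fun l => measurable_timeMap hTm (hτ l)
  have hdelay : ∀ k : C((ℕ → ℝ≥0∞) × (ℕ → F), ℝ), Tendsto (fun l =>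
      ∫ x, k (hitProcess μ T (A l) (timeMap T (τ l) x),
        localProcess T (ψ l) (timeMap T (τ l) x)) ∂μ[|A l] -
      ∫ x, k (hitProcess μ T (A l) x, localProcess T (ψ l) x) ∂μ) atTop (𝓝 0) := by
    intro k
    have h := tendsto_integral_sub_integral_of_isCompact hT
      (measurable_comp_jointProcess (μ := μ) hTm hA hψ k) (M := ‖k‖)
      (fun l x => by simpa using k.norm_coe_le_norm _)
      (tendsto_integral_abs_jointProcess_comp_sub hT hA hpos hrare hψ k) hK hνK
    refine h.congr fun l => ?_
    rw [hν l, integral_map (hθ l).aemeasurable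
      (measurable_comp_jointProcess (μ := μ) hTm hA hψ k l).aestronglyMeasurable]
  have hwait := hdelay ⟨fun z => expNeg (z.1 0), continuous_expNeg.comp (by fun_prop)⟩
  simp only [ContinuousMap.coe_mk] at hwait
  -- Both delayed and undelayed waiting times under `μ_A` are compared with the hitting time under
  -- `μ`.
  have hwait' : Tendsto (fun l => ∫ x, expNeg (hitProcess μ T (A l) (timeMap T (τ l) x) 0) ∂μ[|A l] -
      ∫ x, expNeg (hitProcess μ T (A l) x 0) ∂μ[|A l]) atTop (𝓝 0) := by
    have := hwait.add hlap
    rw [add_zero] at this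
    refine this.congr fun l => ?_
    simp only [hitProcess, Function.iterate_zero, id]
    ring
  let D : ℕ → Set X := fun l => {x | (τ l x : ℕ∞) < hitTime T (A l) x}
  have hD : ∀ l, MeasurableSet (D l) := fun l => by
    have hpair : Measurable fun x => (τ l x, hitTime T (A l) x) :=
      (hτ l).prodMk (measurable_hitTime hTm (hA l))
    exact hpair (MeasurableSet.of_discrete (s := {p : ℕ × ℕ∞ | (p.1 : ℕ∞) < p.2}))
  have hDc : Tendsto (fun l => (μ[|A l]).real (D l)ᶜ) atTop (𝓝 0) := by
    have h1 : Tendsto (fun l => (μ[|A l]).real (D l)) atTop (𝓝 1) := by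
      simpa [Function.comp_def, measureReal_def] using
        (ENNReal.tendsto_toReal ENNReal.one_ne_top).comp hτ_lt
    have h2 := h1.const_sub 1
    rw [sub_self] at h2
    exact h2.congr fun l => (probReal_compl_eq_one_sub (hD l)).symm
  have hb : ∀ y z, |f y - f z| ≤ 2 * ‖f‖ := fun y z => by
    refine (abs_sub _ _).trans ?_
    linarith [f.norm_coe_le_norm y, f.norm_coe_le_norm z, Real.norm_eq_abs (f y),
      Real.norm_eq_abs (f z)]
  have hmain : Tendsto (fun l => ∫ x, (f (hitProcess μ T (A l) (timeMap T (τ l) x),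
      localProcess T (ψ l) (timeMap T (τ l) x)) -
      f (hitProcess μ T (A l) x, localProcess T (ψ l) x)) ∂μ[|A l]) atTop (𝓝 0) := by
    refine tendsto_zero_of_forall_abs_le_add fun δ hδ => ?_
    obtain ⟨C, hC0, hC⟩ := exists_abs_sub_le_of_eq_succ f hδ
    refine ⟨fun l => C * (∫ x, expNeg (hitProcess μ T (A l) (timeMap T (τ l) x) 0) ∂μ[|A l] -
      ∫ x, expNeg (hitProcess μ T (A l) x 0) ∂μ[|A l]) +
      (2 * ‖f‖ + C) * (μ[|A l]).real (D l)ᶜ, ?_, fun l => ?_⟩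
    · simpa using (hwait'.const_mul C).add (hDc.const_mul (2 * ‖f‖ + C))
    · have hm := measurable_comp_jointProcess (μ := μ) hTm hA hψ f l
      have hle : ∀ᵐ x ∂μ[|A l], |f (hitProcess μ T (A l) (timeMap T (τ l) x),
          localProcess T (ψ l) (timeMap T (τ l) x)) -
          f (hitProcess μ T (A l) x, localProcess T (ψ l) x)| ≤
          δ + C * (expNeg (hitProcess μ T (A l) (timeMap T (τ l) x) 0) -
            expNeg (hitProcess μ T (A l) x 0)) +
            (D l)ᶜ.indicator (fun _ => 2 * ‖f‖ + C) x := by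
        filter_upwards [cond_absolutelyContinuous.ae_le
          (ae_hitTime_ne_top hT (hA l) (hpos l))] with x hx
        by_cases h : x ∈ D l
        · obtain ⟨h1, h2⟩ := hitTime_iterate_add (show (τ l x : ℕ∞) < _ from h) hx
          rw [Set.indicator_of_notMem (by simpa using h), add_zero]
          refine (hC _ _ (hitProcess_succ_congr h2) (localProcess_congr h2)).trans_eq ?_
          rw [abs_of_nonneg]
          rw [sub_nonneg]
          refine antitone_expNeg ?_
          simp only [hitProcess, Function.iterate_zero, id, timeMap]
          gcongr
          rw [← h1]
          exact le_self_add
        · rw [Set.indicator_of_mem (by simpa using h)]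
          have h1 := hb (hitProcess μ T (A l) (timeMap T (τ l) x),
            localProcess T (ψ l) (timeMap T (τ l) x))
            (hitProcess μ T (A l) x, localProcess T (ψ l) x)
          have h2 := expNeg_nonneg (hitProcess μ T (A l) (timeMap T (τ l) x) 0)
          have h3 := expNeg_le_one (hitProcess μ T (A l) x 0)
          nlinarith
      have hem : Measurable fun x => expNeg (hitProcess μ T (A l) x 0) :=
        continuous_expNeg.measurable.comp
          ((measurable_pi_apply 0).comp (measurable_hitProcess hTm (hA l)))
      have hei : Integrable (fun x => expNeg (hitProcess μ T (A l) x 0)) (μ[|A l]) :=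
        Integrable.of_bound hem.aestronglyMeasurable 1
          (Eventually.of_forall fun x => abs_expNeg_le_one _)
      have hei' : Integrable (fun x => expNeg (hitProcess μ T (A l) (timeMap T (τ l) x) 0))
          (μ[|A l]) :=
        Integrable.of_bound (hem.comp (hθ l)).aestronglyMeasurable 1
          (Eventually.of_forall fun x => abs_expNeg_le_one _)
      have hind : Integrable ((D l)ᶜ.indicator fun _ => 2 * ‖f‖ + C) (μ[|A l]) :=
        (integrable_const _).indicator (hD l).compl
      have hdiff : Integrable (fun x => C * (expNeg (hitProcess μ T (A l)
          (timeMap T (τ l) x) 0) - expNeg (hitProcess μ T (A l) x 0))) (μ[|A l]) :=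
        (hei'.sub hei).const_mul C
      have hmid : Integrable (fun x => δ + C * (expNeg (hitProcess μ T (A l)
          (timeMap T (τ l) x) 0) - expNeg (hitProcess μ T (A l) x 0))) (μ[|A l]) :=
        (integrable_const δ).add hdiff
      refine abs_integral_le_integral_abs.trans ((integral_mono_ae (Integrable.of_bound
        ((hm.comp (hθ l)).sub hm).abs.aestronglyMeasurable (2 * ‖f‖)
        (Eventually.of_forall fun x => by simpa using hb _ _)) (hmid.add hind) hle).trans ?_)
      rw [integral_add' hmid hind, integral_indicator_const _ (hD l).compl,
        integral_add (integrable_const δ) hdiff, integral_const_mul,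
        integral_sub hei' hei]
      simp only [integral_const, probReal_univ, smul_eq_mul]
      linarith
  have := (hdelay f).sub hmain
  rw [sub_zero] at this
  refine this.congr fun l => ?_
  have hm := measurable_comp_jointProcess (μ := μ) hTm hA hψ f l
  have hfi : Integrable (fun x => f (hitProcess μ T (A l) x, localProcess T (ψ l) x)) (μ[|A l]) :=
    Integrable.of_bound hm.aestronglyMeasurable ‖f‖
      (Eventually.of_forall fun x => f.norm_coe_le_norm _)
  have hfi' : Integrable (fun x => f (hitProcess μ T (A l) (timeMap T (τ l) x),
      localProcess T (ψ l) (timeMap T (τ l) x))) (μ[|A l]) :=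
    Integrable.of_bound (hm.comp (hθ l)).aestronglyMeasurable ‖f‖
      (Eventually.of_forall fun x => f.norm_coe_le_norm _)
  rw [integral_sub hfi' hfi]
  ring

end JointProcesses

/-! ### Convergence in distribution and shifts of the limit law -/

section Limits

/-- Both laws are the infinite product of the common marginal. -/
theorem IsIID.map_shift {Ω E : Type*} [MeasurableSpace Ω] [MeasurableSpace E] {Z : ℕ → Ω → E}
    {P : Measure Ω} (h : IsIID Z P) :
    P.map (fun ω j => Z (j + 1) ω) = P.map (fun ω j => Z j ω) := by
  have h1 := iIndepFun.map_fun_eq_infinitePi_map₀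
    (measurable_pi_lambda _ fun j => h.measurable (j + 1)).aemeasurable
    (h.indep.precomp (add_left_injective 1))
  have h2 := iIndepFun.map_fun_eq_infinitePi_map₀
    (measurable_pi_lambda _ fun j => h.measurable j).aemeasurable h.indep
  rw [h1, h2]
  congr 1
  funext j
  exact (h.identDistrib (j + 1)).map_eq.trans (h.identDistrib j).map_eq.symm

theorem tendstoInDistribution_iff_forall_integral {E Ω : Type*} [TopologicalSpace E]
    [CompactSpace E] [MeasurableSpace E] [OpensMeasurableSpace E] {X : Type*} [MeasurableSpace X]
    [MeasurableSpace Ω] {μ : ℕ → Measure X} [∀ l, IsProbabilityMeasure (μ l)] {P : Measure Ω}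
    [IsProbabilityMeasure P] {Y : ℕ → X → E} {Z : Ω → E} (hY : ∀ l, Measurable (Y l))
    (hZ : Measurable Z) :
    TendstoInDistribution Y atTop Z μ P ↔
      ∀ f : C(E, ℝ), Tendsto (fun l => ∫ x, f (Y l x) ∂μ l) atTop (𝓝 (∫ ω, f (Z ω) ∂P)) := by
  have key : ∀ f : C(E, ℝ), ∀ l, ∫ y, f y ∂(μ l).map (Y l) = ∫ x, f (Y l x) ∂μ l := fun f l =>
    integral_map (hY l).aemeasurable f.continuous.measurable.aestronglyMeasurable
  have key' : ∀ f : C(E, ℝ), ∫ y, f y ∂P.map Z = ∫ ω, f (Z ω) ∂P := fun f =>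
    integral_map hZ.aemeasurable f.continuous.measurable.aestronglyMeasurable
  constructor
  · intro h f
    have := (ProbabilityMeasure.tendsto_iff_forall_integral_tendsto.mp h.tendsto)
      (BoundedContinuousFunction.mkOfCompact f)
    simp only [ProbabilityMeasure.coe_mk, BoundedContinuousFunction.mkOfCompact_apply] at this
    simpa only [key, key'] using this
  · intro h
    refine ⟨fun l => (hY l).aemeasurable, hZ.aemeasurable, ?_⟩
    refine ProbabilityMeasure.tendsto_iff_forall_integral_tendsto.mpr fun f => ?_
    have := h f.toContinuousMap
    simp only [← key, ← key'] at this
    exact this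

end Limits

section LimitLaws

variable {Ω E₁ E₂ : Type*} [MeasurableSpace Ω] [MeasurableSpace E₁] [MeasurableSpace E₂]
  {P : Measure Ω} [IsProbabilityMeasure P] {Y : ℕ → Ω → E₁} {Z : ℕ → Ω → E₂}

/-- Independence makes the joint law a product, so one factor can be shifted without the other. -/
theorem map_shift_fst_eq (hY : IsIID Y P) (hZ : IsIID Z P)
    (h : IndepFun (fun ω j => Y j ω) (fun ω j => Z j ω) P) :
    P.map (fun ω => ((fun j => Y (j + 1) ω, fun j => Z j ω) : (ℕ → E₁) × (ℕ → E₂))) =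
      P.map (fun ω => (fun j => Y j ω, fun j => Z j ω)) := by
  have hYm : Measurable fun ω j => Y j ω := measurable_pi_lambda _ hY.measurable
  have hYm' : Measurable fun ω j => Y (j + 1) ω :=
    measurable_pi_lambda _ fun j => hY.measurable (j + 1)
  have hZm : Measurable fun ω j => Z j ω := measurable_pi_lambda _ hZ.measurable
  have h' : IndepFun (fun ω j => Y (j + 1) ω) (fun ω j => Z j ω) P :=
    h.comp (φ := fun y : ℕ → E₁ => fun j => y (j + 1)) (ψ := id) (by fun_prop) measurable_id
  rw [(indepFun_iff_map_prod_eq_prod_map_map hYm.aemeasurable hZm.aemeasurable).mp h,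
    (indepFun_iff_map_prod_eq_prod_map_map hYm'.aemeasurable hZm.aemeasurable).mp h',
    hY.map_shift]

theorem map_shift_snd_eq (hY : IsIID Y P) (hZ : IsIID Z P)
    (h : IndepFun (fun ω j => Y j ω) (fun ω j => Z j ω) P) :
    P.map (fun ω => ((fun j => Y j ω, fun j => Z (j + 1) ω) : (ℕ → E₁) × (ℕ → E₂))) =
      P.map (fun ω => (fun j => Y j ω, fun j => Z j ω)) := by
  have hYm : Measurable fun ω j => Y j ω := measurable_pi_lambda _ hY.measurable
  have hZm : Measurable fun ω j => Z j ω := measurable_pi_lambda _ hZ.measurable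
  have hZm' : Measurable fun ω j => Z (j + 1) ω :=
    measurable_pi_lambda _ fun j => hZ.measurable (j + 1)
  have h' : IndepFun (fun ω j => Y j ω) (fun ω j => Z (j + 1) ω) P :=
    h.comp (φ := id) (ψ := fun z : ℕ → E₂ => fun j => z (j + 1)) measurable_id (by fun_prop)
  rw [(indepFun_iff_map_prod_eq_prod_map_map hYm.aemeasurable hZm.aemeasurable).mp h,
    (indepFun_iff_map_prod_eq_prod_map_map hYm.aemeasurable hZm'.aemeasurable).mp h',
    hZ.map_shift]

end LimitLaws

end RareEvents

/-! ### The equivalence -/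

open RareEvents in
theorem mainTheorem7
    {X : Type*} [MeasurableSpace X] (μ : Measure X) [IsProbabilityMeasure μ]
    (T : X → X) (hT : Ergodic T μ)
    -- an asymptotically rare sequence of events
    (A : ℕ → Set X) (hA : ∀ l, MeasurableSet (A l)) (hA_pos : ∀ l, 0 < μ (A l))
    (hA_rare : Tendsto (fun l => μ (A l)) atTop (𝓝 0))
    -- local observables with values in a compact metric space
    {F : Type*} [MetricSpace F] [CompactSpace F] [MeasurableSpace F] [BorelSpace F] [Nonempty F]
    (ψ : ∀ l, A l → F) (hψ : ∀ l, Measurable (ψ l))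
    -- the delay times and the compact set of absolutely continuous probability measures
    (τ : ℕ → X → ℕ) (hτ : ∀ l, Measurable (τ l))
    (hτ_lt : Tendsto (fun l => μ[|A l] {x | (τ l x : ℕ∞) < hitTime T (A l) x}) atTop (𝓝 1))
    (K : Set (AbsContProb μ)) (hK : IsCompact K)
    (hτ_K : ∀ l, ∃ ν ∈ K, ν.toMeasure = (μ[|A l]).map (timeMap T (τ l)))
    -- the limit: an independent pair of iid sequences, the first of which is standard exponential
    {Ω : Type*} [MeasurableSpace Ω] (P : Measure Ω) [IsProbabilityMeasure P]
    (Φexp : ℕ → Ω → ℝ≥0∞) (Ψstar : ℕ → Ω → F)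
    (hΦ_iid : IsIID Φexp P) (hΦ_exp : P.map (Φexp 0) = (expMeasure 1).map ENNReal.ofReal)
    (hΨ_iid : IsIID Ψstar P)
    (h_indep : IndepFun (fun ω j => Φexp j ω) (fun ω j => Ψstar j ω) P) :
    haveI : ∀ l, IsProbabilityMeasure (μ[|A l]) :=
      fun l => cond_isProbabilityMeasure (hA_pos l).ne'
    TendstoInDistribution
        (fun l x => (hitProcess μ T (A l) x, localProcess T (ψ l) x)) atTop
        (fun ω => ((fun j => Φexp j ω, fun j => Ψstar j ω) : (ℕ → ℝ≥0∞) × (ℕ → F)))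
        (fun _ => μ) P ↔
      TendstoInDistribution
        (fun l x => (hitProcess μ T (A l) x, localProcessFromZero T (ψ l) x)) atTop
        (fun ω => ((fun j => Φexp j ω, fun j => Ψstar j ω) : (ℕ → ℝ≥0∞) × (ℕ → F)))
        (fun l => μ[|A l]) P := by
  have hprob : ∀ l, IsProbabilityMeasure (μ[|A l]) :=
    fun l => cond_isProbabilityMeasure (hA_pos l).ne'
  have hTm := hT.measurable
  have hfin := fun l => ae_hitTime_ne_top hT (hA l) (hA_pos l)
  have hYm : Measurable fun ω j => Φexp j ω := measurable_pi_lambda _ hΦ_iid.measurable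
  have hZm : Measurable fun ω j => Ψstar j ω := measurable_pi_lambda _ hΨ_iid.measurable
  have hYm' : Measurable fun ω j => Φexp (j + 1) ω :=
    measurable_pi_lambda _ fun j => hΦ_iid.measurable (j + 1)
  have hZm' : Measurable fun ω j => Ψstar (j + 1) ω :=
    measurable_pi_lambda _ fun j => hΨ_iid.measurable (j + 1)
  have hR := fun l => (measurable_hitProcess (μ := μ) hTm (hA l)).prodMk
    (measurable_localProcess hTm (hA l) (hψ l))
  have hR' := fun l => (measurable_hitProcess (μ := μ) hTm (hA l)).prodMk
    (measurable_localProcessFromZero hTm (hA l) (hψ l))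
  rw [tendstoInDistribution_iff_forall_integral hR (hYm.prodMk hZm),
    tendstoInDistribution_iff_forall_integral hR' (hYm.prodMk hZm)]
  have hhalf : ∫ ω, expNeg (Φexp 0 ω) ∂P = 1 / 2 := by
    have hm := continuous_expNeg.measurable
    rw [← integral_map (hΦ_iid.measurable 0).aemeasurable hm.aestronglyMeasurable, hΦ_exp,
      integral_map ENNReal.measurable_ofReal.aemeasurable hm.aestronglyMeasurable,
      integral_expNeg_ofReal_expMeasure]
  have hlap := tendsto_integral_expNeg_half_iff hT.toMeasurePreserving hA hA_pos hA_rare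
  let e : C((ℕ → ℝ≥0∞) × (ℕ → F), ℝ) :=
    ⟨fun z => expNeg (z.1 0), continuous_expNeg.comp (by fun_prop)⟩
  constructor
  · intro h f
    -- The first waiting time alone already yields the Laplace value `1/2`, hence the agreement of
    -- transforms needed for the comparison.
    have h1 := h e
    simp only [e, ContinuousMap.coe_mk, hhalf] at h1
    have h2 := h1.sub (hlap.mp h1)
    rw [sub_self] at h2
    -- Composing `(Φ_A, Ψ̃_A)` with `T_A` drops the first waiting time and turns `Ψ̃_A` into `Ψ_A`;
    -- `k` reads this off `R`, and invariance of `μ_A` under `T_A` closes the argument.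
    let k : C((ℕ → ℝ≥0∞) × (ℕ → F), ℝ) :=
      ⟨fun z => f (fun j => z.1 (j + 1), z.2), f.continuous.comp (by fun_prop)⟩
    have h3 := (tendsto_integral_cond_sub_integral hT hA hA_pos hA_rare hψ hτ hτ_lt hK hτ_K h2
      k).add (h k)
    have hlim : ∫ ω, k (fun j => Φexp j ω, fun j => Ψstar j ω) ∂P =
        ∫ ω, f (fun j => Φexp j ω, fun j => Ψstar j ω) ∂P := by
      have hf := f.continuous.measurable.aestronglyMeasurable
        (μ := P.map (fun ω => ((fun j => Φexp j ω, fun j => Ψstar j ω) :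
          (ℕ → ℝ≥0∞) × (ℕ → F))))
      rw [← integral_map (hYm.prodMk hZm).aemeasurable hf]
      rw [← map_shift_fst_eq hΦ_iid hΨ_iid h_indep] at hf ⊢
      rw [integral_map (hYm'.prodMk hZm).aemeasurable hf]
      rfl
    rw [zero_add, hlim] at h3
    refine h3.congr fun l => ?_
    rw [sub_add_cancel]
    exact integral_cond_comp_entranceMap hT.toMeasurePreserving (hA l) (hfin l)
      (f.continuous.measurable.comp (hR' l)) (M := ‖f‖) (fun x => f.norm_coe_le_norm _)
  · intro h f
    have h1 := h e
    simp only [e, ContinuousMap.coe_mk, hhalf] at h1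
    have h2 := (hlap.mpr h1).sub h1
    rw [sub_self] at h2
    -- Here `Ψ_A` is pointwise the shift of `Ψ̃_A`, so invariance under `T_A` is not used.
    let k : C((ℕ → ℝ≥0∞) × (ℕ → F), ℝ) :=
      ⟨fun z => f (z.1, fun j => z.2 (j + 1)), f.continuous.comp (by fun_prop)⟩
    have h3 := (h k).sub (tendsto_integral_cond_sub_integral hT hA hA_pos hA_rare hψ hτ hτ_lt hK
      hτ_K h2 f)
    have hlim : ∫ ω, k (fun j => Φexp j ω, fun j => Ψstar j ω) ∂P =
        ∫ ω, f (fun j => Φexp j ω, fun j => Ψstar j ω) ∂P := by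
      have hf := f.continuous.measurable.aestronglyMeasurable
        (μ := P.map (fun ω => ((fun j => Φexp j ω, fun j => Ψstar j ω) :
          (ℕ → ℝ≥0∞) × (ℕ → F))))
      rw [← integral_map (hYm.prodMk hZm).aemeasurable hf]
      rw [← map_shift_snd_eq hΦ_iid hΨ_iid h_indep] at hf ⊢
      rw [integral_map (hYm.prodMk hZm').aemeasurable hf]
      rfl
    rw [sub_zero, hlim] at h3
    exact h3.congr fun l => sub_sub_cancel _ _
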